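/- **Theorem 2.** Let $\Delta$ be a finite abstract simplicial complex, i.e. a finite family of finite sets closed under taking subsets (so $\emptyset\in\Delta$), of dimension $d\ge 1$; an $i$-simplex is an element of $\Delta$ of cardinality $i+1$, $f_i^{\Delta}$ is the number of $i$-simplices, and $d$ is the largest $i$ for which there is an $i$-simplex. Put $\widetilde\chi(\Delta)=\sum_{\sigma\in\Delta}(-1)^{\#\sigma-1}$ and $h^{\Delta}(z)=\sum_{i=-1}^{d} f_i^{\Delta}(z-1)^{d-i}$. The barycentric subdivision $\Delta'$ of $\Delta$ consists of $\emptyset$ and all sets $\{\sigma_0\subsetneq\sigma_1\subsetneq\dots\subsetneq\sigma_n\}$, $n\ge 0$, of nonempty simplices of $\Delta$, and $\Delta^{(k)}$ is the $k$-times iterated barycentric subdivision ($\Delta^{(0)}=\Delta$). For $i,j\ge 0$ let $f_{i,j}$ be the number of simplices $\{\sigma_0\subsetneq\dots\subsetneq\sigma_i\}$ of the barycentric subdivision whose largest element $\sigma_i$ is a given $j$-simplex. Let $F_{d,d}=1$, $F_{-1,d}=0$ and, for $0\le i<d$, $$F_{i,d}=\sum_{\ell\ge 0}\ \sum_{i=i_0<i_1<\dots<i_\ell<d}\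 \prod_{m=0}^{\ell}\frac{f_{i_m,i_{m+1}}}{(d+1)!-(i_m+1)!},\qquad i_{\ell+1}:=d .$$ Let $H_d(z)=\sum_{i=-1}^{d}F_{i,d}(z-1)^{d-i}=\sum_{i=0}^{d+1}H_{i,d}\,z^{d+1-i}$; in particular this defines the number $H_{1,d}$. For every $k\ge 0$ let $\rho_\infty^{(k)},\rho_0^{(k)},\rho_1^{(k)},\dots,\rho_{d-1}^{(k)}$ be the $d+1$ complex zeros of $h^{\Delta^{(k)}}$, listed with multiplicity and so that $\rho_\infty^{(k)}$ has the maximum and $\rho_0^{(k)}$ the minimum modulus among them. Then, as $k\to\infty$, $$\rho_\infty^{(k)}\sim -H_{1,d}\,f_d^{\Delta}\,\bigl((d+1)!\bigr)^k$$ and $$|\widetilde\chi(\Delta)|\sim H_{1,d}\,f_d^{\Delta}\,\bigl|\rho_0^{(k)}\bigr|\,\bigl((d+1)!\bigr)^k .$$ Here $a_k\sim b_k$ means $a_k-b_k=o(b_k)$, i.e. $\lim_{k\to\infty} a_k/b_k=1$ whenever $b_k\neq 0$ for all large $k$; if $\widetilde\chi(\Delta)=0$, the second relation says that $\rho_0^{(k)}=0$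 for all large $k$. -/

import Mathlib

open Filter Asymptotics Polynomial
open scoped Nat

/-- A (finite) abstract simplicial complex: a finite family of finite sets that is closed under
taking subsets. The empty set is one of its simplices, and a simplex with `i + 1` elements is an
`i`-simplex. -/
structure FinSimplicialComplex (α : Type*) where
  /-- the simplices, including the empty one -/
  faces : Finset (Finset α)
  /-- every subset of a simplex is a simplex -/
  down_closed : ∀ σ ∈ faces, ∀ τ ⊆ σ, τ ∈ faces

namespace FinSimplicialComplex

variable {α : Type*}

/-- The maximal number of elements of a simplex, that is, the dimension plus one. -/
def dimSucc (Δ : FinSimplicialComplex α) : ℕ := Δ.faces.sup Finset.card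

/-- The dimension: the maximal `d` such that there is a `d`-simplex. -/
def dim (Δ : FinSimplicialComplex α) : ℤ := (Δ.dimSucc : ℤ) - 1

/-- The number of simplices with `n` elements, that is, the number `f_{n-1}` of
`(n-1)`-simplices. -/
def faceCount (Δ : FinSimplicialComplex α) (n : ℕ) : ℕ :=
  (Δ.faces.filter fun σ => σ.card = n).card

/-- The number `f_i` of `i`-simplices, for `0 ≤ i`. -/
def numSimplices (Δ : FinSimplicialComplex α) (i : ℕ) : ℕ := Δ.faceCount (i + 1)

/-- The Euler characteristic `∑_{σ ∈ Δ} (-1)^{#σ - 1}`, where the empty simplex contributes `-1`.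
(The exponent is written `#σ + 1`, which has the same parity as `#σ - 1`.) -/
def eulerChar (Δ : FinSimplicialComplex α) : ℤ := ∑ σ ∈ Δ.faces, (-1) ^ (σ.card + 1)

/-- The `f`-polynomial `∑_{i=-1}^{d} f_i z^{d-i}` with `d = dim Δ`; the summation index here
is `n = i + 1`. -/
noncomputable def fPoly (Δ : FinSimplicialComplex α) : ℤ[X] :=
  ∑ n ∈ Finset.range (Δ.dimSucc + 1), C (Δ.faceCount n : ℤ) * X ^ (Δ.dimSucc - n)

/-- The `h`-polynomial `h(z) = f(z - 1)`. -/
noncomputable def hPoly (Δ : FinSimplicialComplex α) : ℤ[X] := Δ.fPoly.comp (X - 1)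

open Classical in
/-- The barycentric subdivision: its simplices are the empty set and the sets
`{σ₀ ⊊ σ₁ ⊊ ⋯ ⊊ σₙ}` of nonempty simplices of `Δ`, that is, the finite sets of nonempty simplices
which are totally ordered by inclusion. -/
noncomputable def subdivision (Δ : FinSimplicialComplex α) :
    FinSimplicialComplex (Finset α) where
  faces := (Δ.faces.filter Finset.Nonempty).powerset.filter
    fun s => IsChain (· ⊆ ·) (s : Set (Finset α))
  down_closed := by
    intro s hs t hts
    simp only [Finset.mem_filter, Finset.mem_powerset] at hs ⊢
    exact ⟨hts.trans hs.1, hs.2.mono (Finset.coe_subset.2 hts)⟩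

/-- The type in which the vertices of the `k`-th barycentric subdivision live. -/
def IterVertex (α : Type*) : ℕ → Type _
  | 0 => α
  | k + 1 => Finset (IterVertex α k)

/-- The `k`-times iterated barycentric subdivision `Δ^{(k)}`. -/
noncomputable def iterSubdivision (Δ : FinSimplicialComplex α) :
    (k : ℕ) → FinSimplicialComplex (IterVertex α k)
  | 0 => Δ
  | k + 1 => (iterSubdivision Δ k).subdivision

/-- The complex of all subsets of `{0, …, d}`, the standard `d`-simplex. -/
def simplex (d : ℕ) : FinSimplicialComplex (Fin (d + 1)) where
  faces := Finset.univ
  down_closed := fun _ _ _ _ => Finset.mem_univ _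

end FinSimplicialComplex

open Classical in
/-- The number `f_{i,d}`, for `i, d ≥ 0`: the number of simplices `{σ₀ ⊊ ⋯ ⊊ σᵢ}` of the barycentric
subdivision whose largest element `σᵢ` is a given `d`-simplex (here the top simplex of the standard
`d`-simplex). -/
noncomputable def chainNum (i d : ℕ) : ℕ :=
  ((FinSimplicialComplex.simplex d).subdivision.faces.filter
    fun s => s.card = i + 1 ∧ Finset.univ ∈ s).card

/-- For `i = i₀` and the list `i₁, …, i_ℓ`, the product
`∏_{m=0}^{ℓ} f_{i_m, i_{m+1}} / ((d+1)! - (i_m+1)!)`, where `i_{ℓ+1} = d`. -/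
noncomputable def pathWeight (d : ℕ) : ℕ → List ℕ → ℚ
  | i, [] => (chainNum i d : ℚ) / (((d + 1)! : ℚ) - ((i + 1)! : ℚ))
  | i, j :: l =>
      (chainNum i j : ℚ) / (((d + 1)! : ℚ) - ((i + 1)! : ℚ)) * pathWeight d j l

/-- The rational numbers `F_{i,d}` for `0 ≤ i ≤ d`: `F_{d,d} = 1`, and for `i < d` the sum of the
products above over all sequences `i = i₀ < i₁ < ⋯ < i_ℓ < d` with `ℓ ≥ 0`; such a sequence is
given by the set `{i₁, …, i_ℓ}` of numbers strictly between `i` and `d`. -/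
noncomputable def FNum (i d : ℕ) : ℚ :=
  if i = d then 1
  else ∑ S ∈ (Finset.Ioo i d).powerset, pathWeight d i (S.sort (· ≤ ·))

/-- The `F`-polynomial `∑_{i=-1}^{d} F_{i,d} z^{d-i}`, `d ≥ 0`. The term with `i = -1` is absent
because `F_{-1,d} = 0`. -/
noncomputable def FPoly (d : ℕ) : ℚ[X] :=
  ∑ i ∈ Finset.range (d + 1), C (FNum i d) * X ^ (d - i)

/-- The `H`-polynomial `H_d(z) = F_d(z - 1)`. -/
noncomputable def HPoly (d : ℕ) : ℚ[X] := (FPoly d).comp (X - 1)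

/-- The numbers `H_{i,d}`, `0 ≤ i ≤ d + 1`, defined by `H_d(z) = ∑_{i=0}^{d+1} H_{i,d} z^{d+1-i}`. -/
noncomputable def HNum (i d : ℕ) : ℚ := (HPoly d).coeff (d + 1 - i)

/-! A chain of nonempty simplices is classified by its union, so subdivision multiplies the
`f`-vector, as a row vector, by the matrix of the numbers `surjNum n m`. This matrix is triangular
with diagonal entries `m !`. For `d ≥ 1` the last entry `(d + 1)!` exceeds all the others, so the
`f`-vectors divided by `((d + 1)!) ^ k` converge to `f_d` times the eigenvector with last entry 1.
The path sums `F_{i,d}` are the entries of that eigenvector (`FNum_recurrence`,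
`limitFaceCount_eigen`, `FinSimplicialComplex.tendsto_faceCount_iterSubdivision`).

Subdivision commutes with `t ↦ -1 - t` on the polynomials `∑ f_{n-1} t ^ n`
(`sum_surjNum_mul_neg_one_pow_mul_choose`). As the eigenvector is unique, this reflection fixes it
up to sign. Hence the limit `H` of the normalised `h`-polynomials has constant coefficient 0, and
its coefficients at `z` and at `z ^ d` both equal `H_{1,d} = F_{0,d} > 0`.

Each `h` is monic with constant coefficient `± χ̃`, which subdivision preserves. Vieta forces the
largest root `R` to grow like `((d + 1)!) ^ k`, and dividing by `z - R` leaves a quotient converging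
to `H / H_{1,d}`. Its constant coefficient tends to 0, hence so does the smallest root `ρ₀`.
Dividing by `z - ρ₀` as well leaves a polynomial `q` with `q(0) → 1`, and `|χ̃| = |R| |ρ₀| |q(0)|`
gives the second relation (`extreme_roots_asymptotics`). -/

/-! ### Surjection numbers and their reflection identity -/

/-- The number of surjections from a set with `n` elements onto a set with `k` elements, or of
chains of `k` nonempty sets whose union is a given set with `n` elements. -/
def surjNum (n : ℕ) : ℕ → ℕ
  | 0 => if n = 0 then 1 else 0
  | k + 1 => ∑ j : Fin n, n.choose j * surjNum j k

theorem surjNum_zero_right (n : ℕ) : surjNum n 0 = if n = 0 then 1 else 0 := by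
  rw [surjNum]

theorem surjNum_succ_right (n k : ℕ) :
    surjNum n (k + 1) = ∑ j ∈ Finset.range n, n.choose j * surjNum j k := by
  rw [surjNum, Finset.sum_range]

theorem surjNum_eq_zero_of_lt {n k : ℕ} (h : n < k) : surjNum n k = 0 := by
  induction k generalizing n with
  | zero => omega
  | succ k ih =>
    rw [surjNum_succ_right]
    refine Finset.sum_eq_zero fun j hj => ?_
    rw [ih (by have := Finset.mem_range.1 hj; omega), mul_zero]

theorem surjNum_self (n : ℕ) : surjNum n n = n ! := by
  induction n with
  | zero => simp [surjNum_zero_right]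
  | succ n ih =>
    rw [surjNum_succ_right, Finset.sum_range_succ, ih, Finset.sum_eq_zero, Nat.choose_succ_self_right,
      Nat.factorial_succ, zero_add]
    intro j hj
    rw [surjNum_eq_zero_of_lt (Finset.mem_range.1 hj), mul_zero]

theorem surjNum_one_pos {n : ℕ} (hn : 0 < n) : 0 < surjNum n 1 := by
  rw [surjNum_succ_right]
  refine Finset.sum_pos' (fun _ _ => Nat.zero_le _) ⟨0, by simpa using hn, ?_⟩
  simp [surjNum_zero_right]

/-- Compare coefficients of `X ^ l` in the binomial expansion of `(1 - (X + 1)) ^ n = (-X) ^ n`. -/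
theorem sum_neg_one_pow_mul_choose_mul_choose (n l : ℕ) :
    ∑ j ∈ Finset.range (n + 1), (-1 : ℤ) ^ j * n.choose j * j.choose l =
      if l = n then (-1) ^ n else 0 := by
  have h : ∑ j ∈ Finset.range (n + 1), (C ((-1 : ℤ) ^ j * n.choose j)) * (X + 1) ^ j =
      C ((-1 : ℤ) ^ n) * X ^ n := by
    have := add_pow (-(X + 1) : ℤ[X]) 1 n
    rw [show (-(X + 1) + 1 : ℤ[X]) = -X by ring, neg_pow] at this
    simp only [map_pow, map_neg, map_one, map_mul, this]
    refine Finset.sum_congr rfl fun j _ => ?_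
    rw [neg_pow (X + 1 : ℤ[X]) j]
    simp
    ring
  have h2 := congrArg (fun p => p.coeff l) h
  simp only [finsetSum_coeff, coeff_C_mul, coeff_X_add_one_pow, coeff_X_pow] at h2
  rw [h2]
  split_ifs <;> simp

/-- Binomial inversion; it expresses that `t ↦ -1 - t` is an involution. -/
theorem sum_choose_mul_reflect (a : ℕ → ℤ) (n : ℕ) :
    ∑ j ∈ Finset.range (n + 1), (n.choose j : ℤ) *
      ((-1) ^ j * ∑ l ∈ Finset.range (j + 1), (j.choose l : ℤ) * a l) = (-1) ^ n * a n := by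
  have h1 : ∀ j ∈ Finset.range (n + 1), (n.choose j : ℤ) *
      ((-1) ^ j * ∑ l ∈ Finset.range (j + 1), (j.choose l : ℤ) * a l) =
      ∑ l ∈ Finset.range (n + 1), (-1 : ℤ) ^ j * n.choose j * j.choose l * a l := by
    intro j hj
    rw [Finset.mul_sum, Finset.mul_sum]
    have hjn := Finset.mem_range.1 hj
    rw [← Finset.sum_subset (Finset.range_subset_range.2 (show j + 1 ≤ n + 1 by omega))]
    · exact Finset.sum_congr rfl fun l _ => by ring
    · intro l _ hl
      rw [Nat.choose_eq_zero_of_lt (show j < l by simpa using hl)]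
      simp
  rw [Finset.sum_congr rfl h1, Finset.sum_comm]
  simp only [← Finset.sum_mul, sum_neg_one_pow_mul_choose_mul_choose]
  simp

theorem sum_surjNum_extend {R : Type*} [CommRing R] {n K : ℕ} (hK : n ≤ K) (g : ℕ → R) :
    ∑ k ∈ Finset.range (K + 1), (surjNum n k : R) * g k =
      ∑ k ∈ Finset.range (n + 1), (surjNum n k : R) * g k := by
  symm
  refine Finset.sum_subset (Finset.range_subset_range.2 (by omega)) fun k _ hk => ?_
  rw [surjNum_eq_zero_of_lt (by simpa using hk)]
  simp

/-- Expansion of `∑ₖ s(n,k) gₖ` by the recursion for `s`. -/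
theorem sum_surjNum_mul_of_pos {n : ℕ} (hn : 0 < n) (g : ℕ → ℤ) :
    ∑ k ∈ Finset.range (n + 1), (surjNum n k : ℤ) * g k =
      ∑ j ∈ Finset.range n, (n.choose j : ℤ) *
        ∑ k ∈ Finset.range (j + 1), (surjNum j k : ℤ) * g (k + 1) := by
  rw [Finset.sum_range_succ', surjNum_zero_right, if_neg hn.ne']
  simp only [surjNum_succ_right, Nat.cast_sum, Nat.cast_mul, Finset.sum_mul]
  rw [Finset.sum_comm]
  simp only [Nat.cast_zero, zero_mul, add_zero]
  refine Finset.sum_congr rfl fun j hj => ?_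
  have hj := Finset.mem_range.1 hj
  obtain ⟨n, rfl⟩ : ∃ m, n = m + 1 := ⟨n - 1, by omega⟩
  rw [← sum_surjNum_extend (show j ≤ n by omega) fun k => g (k + 1), Finset.mul_sum]
  exact Finset.sum_congr rfl fun k _ => by ring

/-- Subdivision commutes with the involution `t ↦ -1 - t` on `f`-polynomials. -/
theorem sum_surjNum_mul_neg_one_pow_mul_choose (n m : ℕ) :
    ∑ k ∈ Finset.range (n + 1), (surjNum n k : ℤ) * ((-1) ^ k * k.choose m) =
      (-1) ^ n * ∑ j ∈ Finset.range (n + 1), (n.choose j : ℤ) * surjNum j m := by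
  induction n using Nat.strong_induction_on generalizing m with
  | _ n ih =>
  rcases Nat.eq_zero_or_pos n with rfl | hn
  · cases m <;> simp [surjNum_zero_right, surjNum_succ_right]
  rw [sum_surjNum_mul_of_pos hn]
  cases m with
  | zero =>
    have h1 : ∀ j ∈ Finset.range n, (n.choose j : ℤ) *
        ∑ k ∈ Finset.range (j + 1), (surjNum j k : ℤ) * ((-1) ^ (k + 1) * ((k + 1).choose 0 : ℕ)) =
        -((-1 : ℤ) ^ j * n.choose j) := by
      intro j hj
      have := ih j (Finset.mem_range.1 hj) 0
      have h2 : ∑ k ∈ Finset.range (j + 1), (surjNum j k : ℤ) *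
          ((-1) ^ (k + 1) * ((k + 1).choose 0 : ℕ)) =
          -∑ k ∈ Finset.range (j + 1), (surjNum j k : ℤ) * ((-1) ^ k * (k.choose 0 : ℕ)) := by
        rw [← Finset.sum_neg_distrib]
        exact Finset.sum_congr rfl fun k _ => by simp [pow_succ]
      rw [h2, this]
      simp [surjNum_zero_right, mul_comm]
    rw [Finset.sum_congr rfl h1, Finset.sum_neg_distrib]
    have h3 := Int.alternating_sum_range_choose_of_ne hn.ne'
    rw [Finset.sum_range_succ] at h3
    simp only [Nat.choose_self, Nat.cast_one, mul_one] at h3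
    simp [surjNum_zero_right]
    linarith
  | succ m =>
    -- `R` is the right-hand side. Pascal's rule and induction reduce the left-hand side to sums of
    -- `R j (m + 1)` and `R j m` over `j < n`. Binomial inversion evaluates these sums, and the
    -- recursion for `surjNum` evaluates the remaining `R n m`.
    set R : ℕ → ℕ → ℤ := fun n m =>
      (-1) ^ n * ∑ j ∈ Finset.range (n + 1), (n.choose j : ℤ) * surjNum j m with hR
    have h1 : ∀ j ∈ Finset.range n, (n.choose j : ℤ) *
        ∑ k ∈ Finset.range (j + 1), (surjNum j k : ℤ) *
          ((-1) ^ (k + 1) * ((k + 1).choose (m + 1) : ℕ)) =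
        -((n.choose j : ℤ) * R j (m + 1)) - (n.choose j : ℤ) * R j m := by
      intro j hj
      have e1 := ih j (Finset.mem_range.1 hj) m
      have e2 := ih j (Finset.mem_range.1 hj) (m + 1)
      simp only [hR]
      rw [← e1, ← e2, ← mul_neg, ← mul_sub, ← Finset.sum_neg_distrib, ← Finset.sum_sub_distrib]
      congr 1
      refine Finset.sum_congr rfl fun k _ => ?_
      rw [Nat.choose_succ_succ]
      push_cast
      ring
    rw [Finset.sum_congr rfl h1, Finset.sum_sub_distrib, Finset.sum_neg_distrib]
    have b1 := sum_choose_mul_reflect (fun l => (surjNum l (m + 1) : ℤ)) n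
    have b2 := sum_choose_mul_reflect (fun l => (surjNum l m : ℤ)) n
    rw [Finset.sum_range_succ, Nat.choose_self] at b1 b2
    change _ + _ * R n (m + 1) = _ at b1
    change _ + _ * R n m = _ at b2
    change _ = R n (m + 1)
    have b3 : R n m = (-1) ^ n * (surjNum n (m + 1) + surjNum n m) := by
      simp only [hR]
      rw [Finset.sum_range_succ, Nat.choose_self, surjNum_succ_right]
      push_cast
      ring
    simp only [Nat.cast_one, one_mul] at b1 b2
    simp only [hR] at b1 b2 b3 ⊢
    linarith

/-! ### Chains, face numbers and Euler characteristic of the subdivision -/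

open Classical in
/-- The chains of `k` nonempty sets whose union is `σ`. -/
noncomputable def chainsTo {β : Type*} (σ : Finset β) (k : ℕ) : Finset (Finset (Finset β)) :=
  σ.powerset.powerset.filter fun s =>
    ∅ ∉ s ∧ IsChain (· ⊆ ·) (s : Set (Finset β)) ∧ s.card = k ∧ s.sup id = σ

section Chains

open Classical

variable {β : Type*}

theorem mem_chainsTo {σ : Finset β} {k : ℕ} {s : Finset (Finset β)} :
    s ∈ chainsTo σ k ↔
      ∅ ∉ s ∧ IsChain (· ⊆ ·) (s : Set (Finset β)) ∧ s.card = k ∧ s.sup id = σ := by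
  rw [chainsTo, Finset.mem_filter, and_iff_right_iff_imp]
  rintro ⟨-, -, -, rfl⟩
  rw [Finset.mem_powerset]
  intro t ht
  exact Finset.mem_powerset.2 (Finset.le_sup (f := id) ht)

theorem sup_mem_of_isChain {s : Finset (Finset β)} (hs : s.Nonempty)
    (hc : IsChain (· ⊆ ·) (s : Set (Finset β))) : s.sup id ∈ s := by
  rw [← Finset.sup'_eq_sup hs]
  refine Finset.sup'_mem (s : Set (Finset β)) (fun x hx y hy => ?_) s hs id fun i hi => hi
  rcases hc.total hx hy with h | h
  · rwa [sup_eq_right.2 h]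
  · rwa [sup_eq_left.2 h]

/-- The union of a nonempty chain is its largest member. Removing `σ` leaves a chain with union some
`τ ⊊ σ`, and sorting by `τ` gives the recursion of `surjNum`. -/
theorem card_chainsTo (σ : Finset β) (k : ℕ) : (chainsTo σ k).card = surjNum σ.card k := by
  induction k generalizing σ with
  | zero =>
    rw [surjNum_zero_right]
    split_ifs with h
    · rw [Finset.card_eq_zero] at h
      subst h
      rw [Finset.card_eq_one]
      refine ⟨∅, ?_⟩
      ext s
      rw [mem_chainsTo, Finset.mem_singleton, Finset.card_eq_zero]
      constructor
      · exact fun h => h.2.2.1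
      · rintro rfl
        simp
    · rw [Finset.card_eq_zero, Finset.eq_empty_iff_forall_notMem]
      intro s hs
      rw [mem_chainsTo, Finset.card_eq_zero] at hs
      obtain ⟨-, -, rfl, rfl⟩ := hs
      simp at h
  | succ k ih =>
    have key : ∀ s ∈ chainsTo σ (k + 1), σ ∈ s ∧ (s.erase σ).sup id ∈ σ.ssubsets := by
      intro s hs
      obtain ⟨h0, hc, hk, hsup⟩ := mem_chainsTo.1 hs
      have hne : s.Nonempty := Finset.card_pos.1 (by omega)
      have hσ : σ ∈ s := hsup ▸ sup_mem_of_isChain hne hc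
      refine ⟨hσ, Finset.mem_ssubsets.2 (Finset.ssubset_iff_subset_ne.2 ⟨?_, ?_⟩)⟩
      · rw [← hsup]
        exact Finset.sup_mono (Finset.erase_subset _ _)
      · intro he
        rcases (s.erase σ).eq_empty_or_nonempty with h | h
        · rw [h, Finset.sup_empty] at he
          exact h0 (by rw [← Finset.bot_eq_empty, he]; exact hσ)
        · have := sup_mem_of_isChain h (hc.mono (Finset.coe_subset.2 (Finset.erase_subset _ _)))
          rw [he] at this
          simp at this
    rw [Finset.card_eq_sum_card_fiberwise (f := fun s => (s.erase σ).sup id) (t := σ.ssubsets)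
      fun s hs => (key s hs).2]
    have hfib : ∀ τ ∈ σ.ssubsets,
        ((chainsTo σ (k + 1)).filter fun s => (s.erase σ).sup id = τ).card =
          surjNum τ.card k := by
      intro τ hτ
      have hτσ := Finset.mem_ssubsets.1 hτ
      have hnot : ∀ s ∈ chainsTo τ k, σ ∉ s := by
        intro s hs hσ
        obtain ⟨-, -, -, rfl⟩ := mem_chainsTo.1 hs
        exact hτσ.2 (Finset.le_sup (f := id) hσ)
      rw [← ih]
      refine Finset.card_bij' (fun s _ => s.erase σ) (fun s _ => insert σ s) ?_ ?_ ?_ ?_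
      · intro s hs
        obtain ⟨hs, hst⟩ := Finset.mem_filter.1 hs
        have hσ := (key s hs).1
        obtain ⟨h0, hc, hk, hsup⟩ := mem_chainsTo.1 hs
        refine mem_chainsTo.2 ⟨fun h => h0 (Finset.mem_of_mem_erase h),
          hc.mono (Finset.coe_subset.2 (Finset.erase_subset _ _)), ?_, hst⟩
        rw [Finset.card_erase_of_mem hσ, hk, Nat.add_sub_cancel]
      · intro s hs
        have hσ := hnot s hs
        obtain ⟨h0, hc, hk, hsup⟩ := mem_chainsTo.1 hs
        have hsub : ∀ t ∈ s, t ⊆ σ := fun t ht =>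
          (Finset.le_sup (f := id) ht).trans (hsup.le.trans hτσ.1)
        refine Finset.mem_filter.2 ⟨mem_chainsTo.2 ⟨?_, ?_, ?_, ?_⟩, ?_⟩
        · rw [Finset.mem_insert, not_or]
          refine ⟨?_, h0⟩
          rintro rfl
          exact hτσ.2 (Finset.empty_subset _)
        · rw [Finset.coe_insert]
          exact hc.insert fun t ht _ => Or.inr (hsub t ht)
        · rw [Finset.card_insert_of_notMem hσ, hk]
        · rw [Finset.sup_insert, hsup, id, sup_eq_left]
          exact hτσ.1
        · rw [Finset.erase_insert hσ, hsup]
      · intro s hs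
        exact Finset.insert_erase (key s (Finset.mem_filter.1 hs).1).1
      · intro s hs
        exact Finset.erase_insert (hnot s hs)
    rw [Finset.sum_congr rfl hfib, surjNum_succ_right]
    have hp := Finset.sum_powerset_apply_card (fun j => surjNum j k) (x := σ)
    rw [Finset.sum_range_succ, Nat.choose_self, one_smul] at hp
    have hs : ∑ τ ∈ σ.ssubsets, surjNum τ.card k + surjNum σ.card k =
        ∑ τ ∈ σ.powerset, surjNum τ.card k := by
      rw [Finset.ssubsets]
      exact Finset.sum_erase_add _ _ (Finset.mem_powerset_self σ)
    simp only [smul_eq_mul] at hp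
    omega

theorem mem_chainsTo_univ_succ [Fintype β] {k : ℕ} {s : Finset (Finset β)} :
    s ∈ chainsTo Finset.univ (k + 1) ↔
      ∅ ∉ s ∧ IsChain (· ⊆ ·) (s : Set (Finset β)) ∧ s.card = k + 1 ∧ Finset.univ ∈ s := by
  rw [mem_chainsTo]
  refine and_congr_right fun _ => and_congr_right fun hc => and_congr_right fun hk =>
    ⟨fun h => ?_, fun h => top_le_iff.1 (Finset.le_sup (f := id) h)⟩
  rw [← h]
  exact sup_mem_of_isChain (Finset.card_pos.1 (by omega)) hc

namespace FinSimplicialComplex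

/-- Chains are sorted by their union, a simplex of `Δ`; the empty chain has union `∅`, whence `h0`.
-/
theorem faceCount_subdivision (Δ : FinSimplicialComplex β) (h0 : ∅ ∈ Δ.faces) (m : ℕ) :
    Δ.subdivision.faceCount m =
      ∑ n ∈ Finset.range (Δ.dimSucc + 1), Δ.faceCount n * surjNum n m := by
  have hmem : ∀ s, s ∈ Δ.subdivision.faces ↔
      (∀ t ∈ s, t ∈ Δ.faces) ∧ ∅ ∉ s ∧ IsChain (· ⊆ ·) (s : Set (Finset β)) := by
    intro s
    simp only [subdivision, Finset.mem_filter, Finset.mem_powerset, Finset.subset_iff]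
    constructor
    · rintro ⟨h, hc⟩
      exact ⟨fun t ht => (h ht).1, fun h' => by simpa using (h h').2, hc⟩
    · rintro ⟨h, h', hc⟩
      refine ⟨fun t ht => ⟨h t ht, ?_⟩, hc⟩
      rw [Finset.nonempty_iff_ne_empty]
      rintro rfl
      exact h' ht
  have hsup : ∀ s ∈ Δ.subdivision.faces, s.sup id ∈ Δ.faces := by
    intro s hs
    obtain ⟨h1, h2, h3⟩ := (hmem s).1 hs
    rcases s.eq_empty_or_nonempty with rfl | hne
    · simpa using h0
    · exact h1 _ (sup_mem_of_isChain hne h3)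
  rw [faceCount, Finset.card_eq_sum_card_fiberwise (f := fun s => s.sup id) (t := Δ.faces)
    fun s hs => hsup s (Finset.mem_filter.1 hs).1]
  have hfib : ∀ σ ∈ Δ.faces, ((Δ.subdivision.faces.filter fun s => s.card = m).filter
      fun s => s.sup id = σ).card = surjNum σ.card m := by
    intro σ hσ
    rw [← card_chainsTo]
    congr 1
    ext s
    rw [Finset.mem_filter, Finset.mem_filter, hmem, mem_chainsTo]
    constructor
    · rintro ⟨⟨⟨-, h1, h2⟩, h3⟩, h4⟩
      exact ⟨h1, h2, h3, h4⟩
    · rintro ⟨h1, h2, h3, h4⟩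
      refine ⟨⟨⟨fun t ht => Δ.down_closed σ hσ t ?_, h1, h2⟩, h3⟩, h4⟩
      rw [← h4]
      exact Finset.le_sup (f := id) ht
  rw [Finset.sum_congr rfl hfib, ← Finset.sum_fiberwise_of_maps_to (g := Finset.card)
    (t := Finset.range (Δ.dimSucc + 1))
    fun σ hσ => Finset.mem_range.2 (Nat.lt_succ_of_le (Finset.le_sup (f := Finset.card) hσ))]
  refine Finset.sum_congr rfl fun n _ => ?_
  rw [Finset.sum_congr rfl (g := fun _ => surjNum n m)
    fun σ hσ => by rw [(Finset.mem_filter.1 hσ).2], Finset.sum_const, faceCount, smul_eq_mul]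

theorem faceCount_eq_zero_of_lt {Δ : FinSimplicialComplex β} {n : ℕ} (h : Δ.dimSucc < n) :
    Δ.faceCount n = 0 := by
  rw [faceCount, Finset.card_eq_zero, Finset.filter_eq_empty_iff]
  rintro σ hσ rfl
  exact absurd (Finset.le_sup (f := Finset.card) hσ) (not_le.2 h)

theorem faceCount_dimSucc_pos {Δ : FinSimplicialComplex β} (h : Δ.faces.Nonempty) :
    0 < Δ.faceCount Δ.dimSucc := by
  obtain ⟨σ, hσ, h⟩ := Finset.exists_mem_eq_sup Δ.faces h Finset.card
  exact Finset.card_pos.2 ⟨σ, Finset.mem_filter.2 ⟨hσ, h.symm⟩⟩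

theorem dimSucc_eq_of_faceCount {Δ : FinSimplicialComplex β} {D : ℕ} (h1 : 0 < Δ.faceCount D)
    (h2 : ∀ n, D < n → Δ.faceCount n = 0) : Δ.dimSucc = D := by
  refine le_antisymm (Finset.sup_le fun σ hσ => ?_) ?_
  · by_contra! h
    have := h2 _ h
    rw [faceCount, Finset.card_eq_zero, Finset.filter_eq_empty_iff] at this
    exact this hσ rfl
  · by_contra! h
    exact h1.ne' (faceCount_eq_zero_of_lt h)

theorem faceCount_zero {Δ : FinSimplicialComplex β} (h0 : ∅ ∈ Δ.faces) : Δ.faceCount 0 = 1 := by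
  rw [faceCount, Finset.card_eq_one]
  refine ⟨∅, ?_⟩
  ext σ
  rw [Finset.mem_filter, Finset.card_eq_zero, Finset.mem_singleton]
  exact ⟨fun h => h.2, by rintro rfl; exact ⟨h0, rfl⟩⟩

theorem empty_mem_subdivision (Δ : FinSimplicialComplex β) : ∅ ∈ Δ.subdivision.faces := by
  simp [subdivision]

theorem dimSucc_subdivision {Δ : FinSimplicialComplex β} (h0 : ∅ ∈ Δ.faces) :
    Δ.subdivision.dimSucc = Δ.dimSucc := by
  refine dimSucc_eq_of_faceCount ?_ fun n hn => ?_
  · rw [faceCount_subdivision Δ h0]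
    refine Finset.sum_pos' (fun _ _ => Nat.zero_le _) ⟨Δ.dimSucc, by simp, ?_⟩
    rw [surjNum_self]
    exact Nat.mul_pos (faceCount_dimSucc_pos ⟨_, h0⟩) (Nat.factorial_pos _)
  · rw [faceCount_subdivision Δ h0]
    refine Finset.sum_eq_zero fun k hk => ?_
    rw [surjNum_eq_zero_of_lt (by have := Finset.mem_range.1 hk; omega), mul_zero]

theorem empty_mem_iterSubdivision {Δ : FinSimplicialComplex β} (h0 : ∅ ∈ Δ.faces) (k : ℕ) :
    ∅ ∈ (Δ.iterSubdivision k).faces := by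
  cases k with
  | zero => exact h0
  | succ k => exact empty_mem_subdivision _

theorem dimSucc_iterSubdivision {Δ : FinSimplicialComplex β} (h0 : ∅ ∈ Δ.faces) (k : ℕ) :
    (Δ.iterSubdivision k).dimSucc = Δ.dimSucc := by
  induction k with
  | zero => rfl
  | succ k ih => exact (dimSucc_subdivision (empty_mem_iterSubdivision h0 k)).trans ih

theorem faceCount_iterSubdivision_succ {Δ : FinSimplicialComplex β} (h0 : ∅ ∈ Δ.faces)
    (k m : ℕ) : (Δ.iterSubdivision (k + 1)).faceCount m =
      ∑ n ∈ Finset.range (Δ.dimSucc + 1), (Δ.iterSubdivision k).faceCount n * surjNum n m := by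
  rw [← dimSucc_iterSubdivision h0 k]
  exact faceCount_subdivision _ (empty_mem_iterSubdivision h0 k) m

theorem eulerChar_eq_sum_faceCount (Δ : FinSimplicialComplex β) :
    Δ.eulerChar = ∑ n ∈ Finset.range (Δ.dimSucc + 1), (Δ.faceCount n : ℤ) * (-1) ^ (n + 1) := by
  rw [eulerChar, ← Finset.sum_fiberwise_of_maps_to (g := Finset.card)
    (t := Finset.range (Δ.dimSucc + 1))
    fun σ hσ => Finset.mem_range.2 (Nat.lt_succ_of_le (Finset.le_sup (f := Finset.card) hσ))]
  refine Finset.sum_congr rfl fun n _ => ?_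
  rw [Finset.sum_congr rfl (g := fun _ => (-1 : ℤ) ^ (n + 1))
    fun σ hσ => by rw [(Finset.mem_filter.1 hσ).2], Finset.sum_const, faceCount, nsmul_eq_mul]

theorem eulerChar_subdivision {Δ : FinSimplicialComplex β} (h0 : ∅ ∈ Δ.faces) :
    Δ.subdivision.eulerChar = Δ.eulerChar := by
  rw [eulerChar_eq_sum_faceCount, eulerChar_eq_sum_faceCount, dimSucc_subdivision h0]
  simp only [faceCount_subdivision Δ h0, Nat.cast_sum, Finset.sum_mul]
  rw [Finset.sum_comm]
  refine Finset.sum_congr rfl fun n hn => ?_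
  -- For `m = 0` the reflection identity reads `∑ₖ s(n,k) (-1)^k = (-1)^n`.
  have h1 := sum_surjNum_mul_neg_one_pow_mul_choose n 0
  rw [← sum_surjNum_extend (Nat.lt_succ_iff.1 (Finset.mem_range.1 hn))] at h1
  simp [surjNum_zero_right] at h1
  simp only [Nat.cast_mul, mul_assoc, ← Finset.mul_sum, pow_succ]
  rw [← h1]
  simp

theorem eulerChar_iterSubdivision {Δ : FinSimplicialComplex β} (h0 : ∅ ∈ Δ.faces) (k : ℕ) :
    (Δ.iterSubdivision k).eulerChar = Δ.eulerChar := by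
  induction k with
  | zero => rfl
  | succ k ih => exact (eulerChar_subdivision (empty_mem_iterSubdivision h0 k)).trans ih

end FinSimplicialComplex

theorem chainNum_eq_surjNum (i d : ℕ) : chainNum i d = surjNum (d + 1) (i + 1) := by
  have h := card_chainsTo (Finset.univ : Finset (Fin (d + 1))) (i + 1)
  rw [Finset.card_univ, Fintype.card_fin] at h
  rw [← h, chainNum]
  congr 1
  ext s
  simp only [FinSimplicialComplex.subdivision, FinSimplicialComplex.simplex,
    mem_chainsTo_univ_succ, Finset.mem_filter, Finset.mem_powerset, Finset.subset_iff,
    Finset.mem_univ, true_and]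
  constructor
  · rintro ⟨⟨h1, h2⟩, h3, h4⟩
    exact ⟨fun h => by simpa using h1 h, h2, h3, h4⟩
  · rintro ⟨h1, h2, h3, h4⟩
    refine ⟨⟨fun t ht => ?_, h2⟩, h3, h4⟩
    rw [Finset.nonempty_iff_ne_empty]
    rintro rfl
    exact h1 ht

end Chains

/-! ### The numbers `F_{i,d}` as the leading eigenvector -/

/-- A nonempty set is its minimum `j` together with a subset of the numbers above `j`; this peels
off the first step of a path. -/
theorem sum_powerset_Ioo_sort {M : Type*} [AddCommMonoid M] (i d : ℕ) (g : List ℕ → M) :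
    ∑ S ∈ (Finset.Ioo i d).powerset, g (S.sort (· ≤ ·)) =
      g [] + ∑ j ∈ Finset.Ioo i d, ∑ S ∈ (Finset.Ioo j d).powerset,
        g (j :: S.sort (· ≤ ·)) := by
  rw [← Finset.add_sum_erase _ _ (Finset.empty_mem_powerset _), Finset.sort_empty, Finset.sum_sigma']
  congr 1
  symm
  have hlt : ∀ p ∈ (Finset.Ioo i d).sigma (fun j => (Finset.Ioo j d).powerset),
      ∀ b ∈ p.2, p.1 < b := by
    intro p hp b hb
    exact (Finset.mem_Ioo.1 (Finset.mem_powerset.1 (Finset.mem_sigma.1 hp).2 hb)).1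
  refine Finset.sum_bij (fun p _ => insert p.1 p.2) ?_ ?_ ?_ ?_
  · intro p hp
    have h1 := Finset.mem_Ioo.1 (Finset.mem_sigma.1 hp).1
    have h2 := Finset.mem_powerset.1 (Finset.mem_sigma.1 hp).2
    rw [Finset.mem_erase, Finset.mem_powerset]
    refine ⟨Finset.insert_ne_empty _ _, Finset.insert_subset (Finset.mem_Ioo.2 h1) ?_⟩
    exact h2.trans (Finset.Ioo_subset_Ioo h1.1.le le_rfl)
  · intro p hp q hq h
    have hpq : p.1 = q.1 := by
      have h1 : p.1 ∈ insert q.1 q.2 := h ▸ Finset.mem_insert_self _ _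
      have h2 : q.1 ∈ insert p.1 p.2 := h ▸ Finset.mem_insert_self _ _
      rcases Finset.mem_insert.1 h1 with h1 | h1
      · exact h1
      rcases Finset.mem_insert.1 h2 with h2 | h2
      · exact h2.symm
      exact absurd (hlt p hp _ h2) (hlt q hq _ h1).not_gt
    obtain ⟨a, S⟩ := p
    obtain ⟨b, T⟩ := q
    obtain rfl : a = b := hpq
    have e := congrArg (fun U => U.erase a) h
    simp only at e
    rw [Finset.erase_insert fun h => (hlt _ hp _ h).ne rfl,
      Finset.erase_insert fun h => (hlt _ hq _ h).ne rfl] at e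
    exact congrArg _ e
  · intro S hS
    rw [Finset.mem_erase, Finset.mem_powerset] at hS
    have hne := Finset.nonempty_iff_ne_empty.2 hS.1
    refine ⟨⟨S.min' hne, S.erase (S.min' hne)⟩, ?_, Finset.insert_erase (S.min'_mem hne)⟩
    rw [Finset.mem_sigma, Finset.mem_powerset]
    refine ⟨hS.2 (S.min'_mem hne), fun b hb => ?_⟩
    exact Finset.mem_Ioo.2 ⟨S.min'_lt_of_mem_erase_min' hne hb,
      (Finset.mem_Ioo.1 (hS.2 (Finset.mem_of_mem_erase hb))).2⟩
  · intro p hp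
    rw [Finset.sort_insert _ (fun b hb => (hlt p hp b hb).le) fun h => (hlt p hp _ h).ne rfl]

theorem FNum_self (d : ℕ) : FNum d d = 1 := by simp [FNum]

theorem factorial_lt_factorial_succ {n d : ℕ} (hd : 1 ≤ d) (h : n < d + 1) : n ! < (d + 1)! := by
  rcases Nat.eq_zero_or_pos n with rfl | hn
  · have := Nat.self_le_factorial (d + 1)
    rw [Nat.factorial_zero]
    omega
  · exact (Nat.factorial_lt hn).2 h

theorem FNum_recurrence {i d : ℕ} (h : i < d) :
    (((d + 1)! : ℚ) - ((i + 1)! : ℚ)) * FNum i d =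
      ∑ j ∈ Finset.Ioc i d, (chainNum i j : ℚ) * FNum j d := by
  have h0 : (((d + 1)! : ℚ) - ((i + 1)! : ℚ)) ≠ 0 := by
    rw [sub_ne_zero, Nat.cast_injective.ne_iff]
    exact (factorial_lt_factorial_succ (by omega) (by omega)).ne'
  rw [FNum, if_neg h.ne, sum_powerset_Ioo_sort, mul_add, ← Finset.Ioo_insert_right h,
    Finset.sum_insert (by simp), FNum_self, Finset.mul_sum]
  congr 1
  · rw [pathWeight]
    field_simp
  · refine Finset.sum_congr rfl fun j hj => ?_
    rw [FNum, if_neg (Finset.mem_Ioo.1 hj).2.ne, Finset.mul_sum, Finset.mul_sum]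
    refine Finset.sum_congr rfl fun S _ => ?_
    rw [pathWeight]
    field_simp

theorem downward_induction {P : ℕ → Prop} {D : ℕ}
    (h : ∀ m ≤ D, (∀ j, m < j → j ≤ D → P j) → P m) {m : ℕ} (hm : m ≤ D) : P m := by
  obtain ⟨r, hr⟩ : ∃ r, r = D - m := ⟨_, rfl⟩
  induction r using Nat.strong_induction_on generalizing m with
  | _ r ih =>
    subst hr
    exact h m hm fun j hmj hj => ih (D - j) (by omega) hj rfl

theorem FNum_nonneg {i d : ℕ} (h : i ≤ d) : 0 ≤ FNum i d := by
  refine downward_induction (P := fun i => 0 ≤ FNum i d) (fun i hi ih => ?_) h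
  rcases hi.eq_or_lt with rfl | hi
  · rw [FNum_self]
    exact zero_le_one
  have h0 : (0 : ℚ) < ((d + 1)! : ℚ) - ((i + 1)! : ℚ) := by
    rw [sub_pos, Nat.cast_lt]
    exact factorial_lt_factorial_succ (by omega) (by omega)
  refine nonneg_of_mul_nonneg_right ?_ h0
  rw [FNum_recurrence hi]
  refine Finset.sum_nonneg fun j hj => mul_nonneg (Nat.cast_nonneg _) ?_
  exact ih j (Finset.mem_Ioc.1 hj).1 (Finset.mem_Ioc.1 hj).2

/-- In the recurrence all terms are nonnegative and the one with `j = d` is positive. This makes the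
constants in both asymptotic relations nonzero. -/
theorem FNum_zero_pos (d : ℕ) : 0 < FNum 0 d := by
  rcases Nat.eq_zero_or_pos d with rfl | hd
  · rw [FNum_self]
    exact zero_lt_one
  have h0 : (0 : ℚ) < ((d + 1)! : ℚ) - ((0 + 1)! : ℚ) := by
    rw [sub_pos, Nat.cast_lt]
    exact factorial_lt_factorial_succ (by omega) (by omega)
  refine pos_of_mul_pos_right ?_ h0.le
  rw [FNum_recurrence hd]
  refine Finset.sum_pos' (fun j hj => mul_nonneg (Nat.cast_nonneg _)
    (FNum_nonneg (Finset.mem_Ioc.1 hj).2)) ⟨d, by simpa using hd, ?_⟩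
  rw [FNum_self, mul_one, Nat.cast_pos, chainNum_eq_surjNum]
  exact surjNum_one_pos (by omega)

/-- The limit of the normalised number of simplices with `n` elements. -/
noncomputable def limitFaceCount (d n : ℕ) : ℝ := if n = 0 then 0 else FNum (n - 1) d

theorem limitFaceCount_zero (d : ℕ) : limitFaceCount d 0 = 0 := if_pos rfl

theorem limitFaceCount_succ (d n : ℕ) : limitFaceCount d (n + 1) = FNum n d := by
  simp [limitFaceCount]

theorem sum_mul_surjNum_split {D m : ℕ} (hm : m ≤ D) (G : ℕ → ℝ) :
    ∑ j ∈ Finset.range (D + 1), G j * surjNum j m =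
      G m * (m ! : ℝ) + ∑ j ∈ Finset.Ioc m D, G j * surjNum j m := by
  rw [← Finset.sum_subset (s₁ := Finset.Icc m D), ← Finset.Ioc_insert_left hm,
    Finset.sum_insert (by simp), surjNum_self]
  · intro j hj
    have := Finset.mem_Icc.1 hj
    exact Finset.mem_range.2 (by omega)
  · intro j hj hj'
    rw [surjNum_eq_zero_of_lt, Nat.cast_zero, mul_zero]
    rw [Finset.mem_range] at hj
    rw [Finset.mem_Icc] at hj'
    omega

theorem limitFaceCount_eigen {d : ℕ} {m : ℕ} (hm : m ≤ d + 1) :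
    ((d + 1)! : ℝ) * limitFaceCount d m =
      ∑ j ∈ Finset.range (d + 1 + 1), limitFaceCount d j * surjNum j m := by
  cases m with
  | zero =>
    rw [limitFaceCount_zero, mul_zero, Finset.sum_range_succ', Finset.sum_eq_zero]
    · simp [limitFaceCount_zero]
    · intro j _
      simp [surjNum_zero_right]
  | succ i =>
    rw [sum_mul_surjNum_split hm]
    rcases (Nat.le_of_succ_le_succ hm).eq_or_lt with rfl | hi
    · simp [mul_comm]
    have h := congrArg (fun x : ℚ => (x : ℝ)) (FNum_recurrence hi)
    simp only [Rat.cast_mul, Rat.cast_sub, Rat.cast_natCast, Rat.cast_sum] at h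
    rw [limitFaceCount_succ]
    have h2 : ∑ j ∈ Finset.Ioc (i + 1) (d + 1), limitFaceCount d j * surjNum j (i + 1) =
        ∑ j ∈ Finset.Ioc i d, (chainNum i j : ℝ) * FNum j d := by
      rw [← Finset.image_add_right_Ioc, Finset.sum_image fun a _ b _ h => Nat.succ_injective h]
      refine Finset.sum_congr rfl fun j _ => ?_
      rw [limitFaceCount_succ, chainNum_eq_surjNum, mul_comm]
    rw [h2, ← h]
    ring

/-- Below the last index the factor `(d + 1)! - m !` is nonzero, so the triangular system determines
`G` from its last entry downwards. -/
theorem eigen_unique {d : ℕ} (hd : 1 ≤ d) {G : ℕ → ℝ}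
    (hG : ∀ m ≤ d + 1, ((d + 1)! : ℝ) * G m =
      ∑ j ∈ Finset.range (d + 1 + 1), G j * surjNum j m) {m : ℕ} (hm : m ≤ d + 1) :
    G m = G (d + 1) * limitFaceCount d m := by
  refine downward_induction (P := fun m => G m = G (d + 1) * limitFaceCount d m)
    (fun m hm ih => ?_) hm
  rcases hm.eq_or_lt with rfl | hlt
  · rw [limitFaceCount_succ, FNum_self, Rat.cast_one, mul_one]
  have h1 := hG m hm
  have h2 := limitFaceCount_eigen hm
  rw [sum_mul_surjNum_split hm] at h1 h2
  have h3 : ∑ j ∈ Finset.Ioc m (d + 1), G j * surjNum j m =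
      G (d + 1) * ∑ j ∈ Finset.Ioc m (d + 1), limitFaceCount d j * surjNum j m := by
    rw [Finset.mul_sum]
    refine Finset.sum_congr rfl fun j hj => ?_
    rw [ih j (Finset.mem_Ioc.1 hj).1 (Finset.mem_Ioc.1 hj).2, mul_assoc]
  have h0 : ((d + 1)! : ℝ) - (m ! : ℝ) ≠ 0 := by
    rw [sub_ne_zero, Nat.cast_injective.ne_iff]
    exact (factorial_lt_factorial_succ hd hlt).ne'
  refine mul_left_cancel₀ h0 ?_
  rw [h3] at h1
  linear_combination h1 - G (d + 1) * h2

/-- The Dehn–Sommerville relations for the limit of the `f`-vectors. -/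
theorem sum_limitFaceCount_mul_choose {d : ℕ} (hd : 1 ≤ d) {m : ℕ} (hm : m ≤ d + 1) :
    ∑ n ∈ Finset.range (d + 1 + 1), limitFaceCount d n * ((-1) ^ n * n.choose m) =
      (-1) ^ (d + 1) * limitFaceCount d m := by
  -- The reflected eigenvector is again an eigenvector, because reflection commutes with
  -- subdivision. Its last entry is `(-1) ^ (d + 1)`.
  have key := eigen_unique hd (G := fun m => ∑ n ∈ Finset.range (d + 1 + 1),
    limitFaceCount d n * ((-1) ^ n * n.choose m)) (fun m _ => ?_) hm
  · rw [key]
    congr 1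
    rw [Finset.sum_range_succ, Finset.sum_eq_zero, limitFaceCount_succ, FNum_self]
    · simp
    · intro n hn
      rw [Nat.choose_eq_zero_of_lt (Finset.mem_range.1 hn)]
      simp
  · have h1 : ∀ n ∈ Finset.range (d + 1 + 1),
        ((d + 1)! : ℝ) * (limitFaceCount d n * ((-1) ^ n * n.choose m)) =
        ∑ j ∈ Finset.range (d + 1 + 1),
          limitFaceCount d j * ((surjNum j n : ℝ) * ((-1) ^ n * n.choose m)) := by
      intro n hn
      rw [← mul_assoc, limitFaceCount_eigen (Nat.lt_succ_iff.1 (Finset.mem_range.1 hn)),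
        Finset.sum_mul]
      exact Finset.sum_congr rfl fun j _ => by ring
    have h2 : ∀ j ∈ Finset.range (d + 1 + 1), ∑ n ∈ Finset.range (d + 1 + 1),
        (surjNum j n : ℝ) * ((-1) ^ n * n.choose m) =
        ∑ l ∈ Finset.range (d + 1 + 1), (-1) ^ j * (j.choose l : ℝ) * surjNum l m := by
      intro j hj
      have hj := Nat.lt_succ_iff.1 (Finset.mem_range.1 hj)
      rw [sum_surjNum_extend hj]
      have h := congrArg (fun x : ℤ => (x : ℝ)) (sum_surjNum_mul_neg_one_pow_mul_choose j m)
      push_cast at h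
      rw [h, Finset.mul_sum,
        ← Finset.sum_subset (Finset.range_subset_range.2 (show j + 1 ≤ d + 1 + 1 by omega))]
      · exact Finset.sum_congr rfl fun l _ => by ring
      · intro l _ hl
        rw [Nat.choose_eq_zero_of_lt (show j < l by simpa using hl)]
        simp
    rw [Finset.mul_sum, Finset.sum_congr rfl h1, Finset.sum_comm]
    simp only [← Finset.mul_sum]
    rw [Finset.sum_congr rfl fun j hj => by rw [h2 j hj]]
    simp only [Finset.mul_sum, Finset.sum_mul]
    rw [Finset.sum_comm]
    exact Finset.sum_congr rfl fun l _ => Finset.sum_congr rfl fun j _ => by ring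

/-! ### Convergence of the normalised face numbers -/

theorem tendsto_zero_of_affine_recurrence {a : ℝ} (ha0 : 0 ≤ a) (ha : a < 1) {u e : ℕ → ℝ}
    (hu : ∀ k, u (k + 1) = a * u k + e k) (he : Tendsto e atTop (nhds 0)) :
    Tendsto u atTop (nhds 0) := by
  rw [Metric.tendsto_atTop] at he ⊢
  intro ε hε
  have h1a : 0 < 1 - a := by linarith
  -- With this bound on the error, `ε / 2` is the fixed point of `t ↦ a * t + ε / 2 * (1 - a)`.
  obtain ⟨K, hK⟩ := he (ε / 2 * (1 - a)) (by positivity)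
  have hb : ∀ m, |u (K + m)| ≤ a ^ m * |u K| + ε / 2 := by
    intro m
    induction m with
    | zero => simp; positivity
    | succ m ih =>
      have h1 := hK (K + m) (by omega)
      rw [Real.dist_0_eq_abs] at h1
      rw [← add_assoc, hu]
      calc |a * u (K + m) + e (K + m)| ≤ |a * u (K + m)| + |e (K + m)| := abs_add_le _ _
        _ ≤ a * (a ^ m * |u K| + ε / 2) + ε / 2 * (1 - a) := by
            rw [abs_mul, abs_of_nonneg ha0]
            gcongr
        _ = _ := by ring
  have h2 : Tendsto (fun m => a ^ m * |u K|) atTop (nhds 0) := by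
    simpa using (tendsto_pow_atTop_nhds_zero_of_lt_one ha0 ha).mul_const |u K|
  obtain ⟨M, hM⟩ := Metric.tendsto_atTop.1 h2 (ε / 2) (by positivity)
  refine ⟨K + M, fun n hn => ?_⟩
  obtain ⟨m, rfl⟩ : ∃ m, n = K + m := ⟨n - K, by omega⟩
  have h3 := hM m (by omega)
  rw [Real.dist_0_eq_abs] at h3 ⊢
  have := hb m
  have := le_abs_self (a ^ m * |u K|)
  linarith

theorem tendsto_of_affine_recurrence {a b : ℝ} (ha0 : 0 ≤ a) (ha : a < 1) {y c : ℕ → ℝ}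
    (hy : ∀ k, y (k + 1) = a * y k + c k) (hc : Tendsto c atTop (nhds b)) {L : ℝ}
    (hL : L = a * L + b) : Tendsto y atTop (nhds L) := by
  have := tendsto_zero_of_affine_recurrence ha0 ha (u := fun k => y k - L)
    (e := fun k => c k - b) (fun k => by rw [hy]; linear_combination -hL) ?_
  · simpa using this.add_const L
  · simpa using hc.sub_const b

namespace FinSimplicialComplex

variable {α : Type*}

/-- The last entry is constant. Each lower one obeys an affine recurrence with ratio `m ! / (d + 1)!
< 1`, whose inhomogeneous term converges by downward induction; the eigenvector equation identifies
the fixed point. -/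
theorem tendsto_faceCount_iterSubdivision {Δ : FinSimplicialComplex α} (h0 : ∅ ∈ Δ.faces)
    {d : ℕ} (hd : 1 ≤ d) (hdim : Δ.dimSucc = d + 1) {n : ℕ} (hn : n ≤ d + 1) :
    Tendsto (fun k => ((Δ.iterSubdivision k).faceCount n : ℝ) / ((d + 1)! : ℝ) ^ k) atTop
      (nhds (Δ.numSimplices d * limitFaceCount d n)) := by
  have hN : ((d + 1)! : ℝ) ≠ 0 := Nat.cast_ne_zero.2 (Nat.factorial_ne_zero _)
  have hN' : (0 : ℝ) < ((d + 1)! : ℝ) := Nat.cast_pos.2 (Nat.factorial_pos _)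
  have hrec : ∀ m ≤ d + 1, ∀ k,
      ((Δ.iterSubdivision (k + 1)).faceCount m : ℝ) / ((d + 1)! : ℝ) ^ (k + 1) =
      (m ! : ℝ) / ((d + 1)! : ℝ) *
        (((Δ.iterSubdivision k).faceCount m : ℝ) / ((d + 1)! : ℝ) ^ k) +
      (∑ j ∈ Finset.Ioc m (d + 1), ((Δ.iterSubdivision k).faceCount j : ℝ) /
        ((d + 1)! : ℝ) ^ k * surjNum j m) / ((d + 1)! : ℝ) := by
    intro m hm k
    have := congrArg (fun x : ℕ => (x : ℝ)) (faceCount_iterSubdivision_succ h0 k m)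
    simp only [Nat.cast_sum, Nat.cast_mul] at this
    rw [hdim, sum_mul_surjNum_split hm fun j => ((Δ.iterSubdivision k).faceCount j : ℝ)] at this
    have hs : ∑ j ∈ Finset.Ioc m (d + 1), ((Δ.iterSubdivision k).faceCount j : ℝ) /
        ((d + 1)! : ℝ) ^ k * surjNum j m = (∑ j ∈ Finset.Ioc m (d + 1),
        ((Δ.iterSubdivision k).faceCount j : ℝ) * surjNum j m) / ((d + 1)! : ℝ) ^ k := by
      rw [Finset.sum_div]
      exact Finset.sum_congr rfl fun j _ => by ring
    rw [this, hs, pow_succ]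
    field_simp
  refine downward_induction (P := fun n => Tendsto (fun k =>
    ((Δ.iterSubdivision k).faceCount n : ℝ) / ((d + 1)! : ℝ) ^ k) atTop
      (nhds (Δ.numSimplices d * limitFaceCount d n))) (fun m hm ih => ?_) hn
  rcases hm.eq_or_lt with rfl | hlt
  · have hconst : ∀ k, ((Δ.iterSubdivision k).faceCount (d + 1) : ℝ) / ((d + 1)! : ℝ) ^ k =
        Δ.numSimplices d := by
      intro k
      induction k with
      | zero => simp [numSimplices, iterSubdivision]; rfl
      | succ k ih' =>
        rw [hrec _ le_rfl, ih', div_self hN]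
        simp
    simp only [hconst, limitFaceCount_succ, FNum_self, Rat.cast_one, mul_one]
    exact tendsto_const_nhds
  · refine tendsto_of_affine_recurrence (by positivity) ?_ (hrec m hm)
      ((tendsto_finsetSum _ fun j hj =>
        (ih j (Finset.mem_Ioc.1 hj).1 (Finset.mem_Ioc.1 hj).2).mul_const _).div_const _) ?_
    · rw [div_lt_one hN', Nat.cast_lt]
      exact factorial_lt_factorial_succ hd hlt
    · have h := limitFaceCount_eigen hm
      rw [sum_mul_surjNum_split hm] at h
      simp only [mul_assoc, ← Finset.mul_sum]
      field_simp
      linear_combination (Δ.numSimplices d : ℝ) * h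

/-! ### Coefficients of the `h`-polynomials and their limits -/

theorem coeff_X_sub_one_pow {R : Type*} [CommRing R] (n j : ℕ) :
    ((X - 1 : R[X]) ^ n).coeff j = (-1) ^ (n - j) * n.choose j := by
  rw [show (X - 1 : R[X]) = X + C (-1) by simp [sub_eq_add_neg], coeff_X_add_C_pow]

theorem hPoly_coeff (Δ : FinSimplicialComplex α) (j : ℕ) :
    Δ.hPoly.coeff j = ∑ n ∈ Finset.range (Δ.dimSucc + 1),
      (Δ.faceCount n : ℤ) * ((-1) ^ (Δ.dimSucc - n - j) * (Δ.dimSucc - n).choose j) := by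
  simp only [hPoly, fPoly, Polynomial.sum_comp, mul_comp, C_comp, X_pow_comp, finsetSum_coeff,
    coeff_C_mul, coeff_X_sub_one_pow]

/-- Up to sign, `h(0) = f(-1)` is the alternating sum of the face numbers. -/
theorem hPoly_coeff_zero (Δ : FinSimplicialComplex α) :
    |Δ.hPoly.coeff 0| = |Δ.eulerChar| := by
  rw [hPoly_coeff, eulerChar_eq_sum_faceCount]
  have h : ∑ n ∈ Finset.range (Δ.dimSucc + 1),
      (Δ.faceCount n : ℤ) * ((-1) ^ (Δ.dimSucc - n - 0) * ((Δ.dimSucc - n).choose 0 : ℕ)) =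
      (-1) ^ (Δ.dimSucc + 1) * ∑ n ∈ Finset.range (Δ.dimSucc + 1),
        (Δ.faceCount n : ℤ) * (-1) ^ (n + 1) := by
    rw [Finset.mul_sum]
    refine Finset.sum_congr rfl fun n hn => ?_
    obtain ⟨m, hm⟩ := Nat.exists_eq_add_of_le (Nat.lt_succ_iff.1 (Finset.mem_range.1 hn))
    rw [hm, Nat.add_sub_cancel_left]
    have : ((-1 : ℤ) ^ n) * (-1) ^ n = 1 := by rw [← mul_pow]; simp
    simp only [pow_succ, pow_add, Nat.sub_zero, Nat.choose_zero_right, Nat.cast_one]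
    linear_combination (-(Δ.faceCount n : ℤ) * (-1) ^ m) * this
  rw [h, abs_mul, abs_pow, abs_neg, abs_one, one_pow, one_mul]

theorem hPoly_monic {Δ : FinSimplicialComplex α} (h0 : ∅ ∈ Δ.faces) : Δ.hPoly.Monic := by
  refine Polynomial.Monic.comp_X_sub_C (p := Δ.fPoly) ?_ 1
  refine monic_of_natDegree_le_of_coeff_eq_one Δ.dimSucc ?_ ?_
  · refine natDegree_sum_le_of_forall_le _ _ fun n _ => ?_
    exact (natDegree_C_mul_X_pow_le _ _).trans (Nat.sub_le _ _)
  · rw [fPoly, finsetSum_coeff, Finset.sum_range_succ', Finset.sum_eq_zero]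
    · simp [faceCount_zero h0]
    · intro n hn
      have := Finset.mem_range.1 hn
      rw [coeff_C_mul, coeff_X_pow, if_neg (by omega), mul_zero]

end FinSimplicialComplex

theorem HNum_one (d : ℕ) : HNum 1 d = FNum 0 d := by
  simp only [HNum, HPoly, FPoly, Polynomial.sum_comp, mul_comp, C_comp, X_pow_comp, finsetSum_coeff,
    coeff_C_mul, FinSimplicialComplex.coeff_X_sub_one_pow]
  rw [Finset.sum_range_succ', Finset.sum_eq_zero]
  · simp
  · intro n hn
    have := Finset.mem_range.1 hn
    rw [Nat.choose_eq_zero_of_lt (by omega)]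
    simp

/-- The coefficient of `z^j` in `∑ₙ Fₙ (z - 1)^{d+1-n}`. -/
noncomputable def limitHCoeff (d j : ℕ) : ℝ :=
  ∑ n ∈ Finset.range (d + 1 + 1),
    limitFaceCount d n * ((-1) ^ (d + 1 - n - j) * (d + 1 - n).choose j)

theorem limitHCoeff_top (d : ℕ) : limitHCoeff d d = HNum 1 d := by
  rw [limitHCoeff, Finset.sum_range_succ', Finset.sum_range_succ', Finset.sum_eq_zero, HNum_one]
  · simp [limitFaceCount_zero, limitFaceCount_succ]
  · intro n hn
    have := Finset.mem_range.1 hn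
    rw [Nat.choose_eq_zero_of_lt (by omega)]
    simp

theorem limitHCoeff_zero {d : ℕ} (hd : 1 ≤ d) : limitHCoeff d 0 = 0 := by
  have h := sum_limitFaceCount_mul_choose hd (Nat.zero_le (d + 1))
  rw [limitFaceCount_zero, mul_zero] at h
  rw [limitHCoeff, ← mul_zero ((-1 : ℝ) ^ (d + 1)), ← h, Finset.mul_sum]
  refine Finset.sum_congr rfl fun n hn => ?_
  obtain ⟨m, hm⟩ := Nat.exists_eq_add_of_le (Nat.lt_succ_iff.1 (Finset.mem_range.1 hn))
  have : ((-1 : ℝ) ^ n) * (-1) ^ n = 1 := by rw [← mul_pow]; simp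
  rw [hm, Nat.add_sub_cancel_left]
  simp only [pow_add, Nat.sub_zero, Nat.choose_zero_right, Nat.cast_one]
  linear_combination (-limitFaceCount d n * (-1) ^ m) * this

theorem limitHCoeff_one {d : ℕ} (hd : 1 ≤ d) : limitHCoeff d 1 = HNum 1 d := by
  have h0 := sum_limitFaceCount_mul_choose hd (Nat.zero_le (d + 1))
  have h1 := sum_limitFaceCount_mul_choose hd (show 1 ≤ d + 1 by omega)
  rw [limitFaceCount_zero, mul_zero] at h0
  rw [limitFaceCount_succ, ← HNum_one] at h1
  have hs : ((-1 : ℝ) ^ (d + 1)) * (-1) ^ (d + 1) = 1 := by rw [← mul_pow]; simp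
  -- The factor `d + 1 - n` in the coefficient of `z` is split, leading to the Dehn–Sommerville
  -- relations for `m = 1` and `m = 0`.
  have key : limitHCoeff d 1 = (-1) ^ (d + 1) *
      (∑ n ∈ Finset.range (d + 1 + 1), limitFaceCount d n * ((-1) ^ n * n.choose 1)) -
      (-1) ^ (d + 1) * (d + 1) *
      ∑ n ∈ Finset.range (d + 1 + 1), limitFaceCount d n * ((-1) ^ n * n.choose 0) := by
    rw [limitHCoeff, Finset.mul_sum, Finset.mul_sum, ← Finset.sum_sub_distrib]
    refine Finset.sum_congr rfl fun n hn => ?_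
    obtain ⟨m, hm⟩ := Nat.exists_eq_add_of_le (Nat.lt_succ_iff.1 (Finset.mem_range.1 hn))
    have : ((-1 : ℝ) ^ n) * (-1) ^ n = 1 := by rw [← mul_pow]; simp
    have hm' : (d : ℝ) + 1 = n + m := by exact_mod_cast hm
    rw [hm', hm, Nat.add_sub_cancel_left]
    simp only [pow_add, Nat.choose_zero_right, Nat.choose_one_right, Nat.cast_one]
    -- For `m = 0` the exponent `m - 1` is truncated, but the binomial factor vanishes.
    cases m with
    | zero => simp; ring
    | succ m =>
      rw [Nat.add_sub_cancel]
      push_cast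
      simp only [pow_succ]
      linear_combination (-limitFaceCount d n * (-1) ^ m * (m + 1)) * this
  rw [key, h0, h1]
  linear_combination (HNum 1 d : ℝ) * hs

theorem FinSimplicialComplex.tendsto_hPoly_coeff {α : Type*} {Δ : FinSimplicialComplex α}
    (h0 : ∅ ∈ Δ.faces) {d : ℕ} (hd : 1 ≤ d) (hdim : Δ.dimSucc = d + 1) (j : ℕ) :
    Tendsto (fun k => ((Δ.iterSubdivision k).hPoly.coeff j : ℝ) / ((d + 1)! : ℝ) ^ k) atTop
      (nhds (Δ.numSimplices d * limitHCoeff d j)) := by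
  have h := tendsto_finsetSum (Finset.range (d + 1 + 1)) fun n hn =>
    (tendsto_faceCount_iterSubdivision h0 hd hdim
      (Nat.lt_succ_iff.1 (Finset.mem_range.1 hn))).mul_const
        ((-1 : ℝ) ^ (d + 1 - n - j) * (d + 1 - n).choose j)
  convert h using 2 with k
  · rw [hPoly_coeff, dimSucc_iterSubdivision h0, hdim]
    push_cast
    rw [Finset.sum_div]
    exact Finset.sum_congr rfl fun n _ => by ring
  · rw [limitHCoeff, Finset.mul_sum]
    exact Finset.sum_congr rfl fun n _ => by ring

/-! ### Extreme roots of polynomials with geometrically growing coefficients -/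

theorem tendsto_zero_of_pow_norm_le {u v : ℕ → ℂ} {n : ℕ} (h : ∀ k, ‖u k‖ ^ n ≤ ‖v k‖)
    (hv : Tendsto v atTop (nhds 0)) : Tendsto u atTop (nhds 0) := by
  rw [Metric.tendsto_atTop] at hv ⊢
  intro ε hε
  obtain ⟨K, hK⟩ := hv (ε ^ n) (by positivity)
  refine ⟨K, fun k hk => ?_⟩
  have := hK k hk
  rw [dist_zero_right] at this ⊢
  exact lt_of_pow_lt_pow_left₀ n hε.le ((h k).trans_lt this)

/-- Division by a linear factor whose root grows like the coefficients yields a quotient whose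
coefficients converge. -/
theorem tendsto_quotient_coeff {d : ℕ} {N : ℝ} (hN : 1 < N) {R : ℕ → ℂ} {g : ℕ → ℂ[X]}
    {a : ℕ → ℂ} (hg : ∀ k, (g k).coeff (d + 1) = 1)
    (hlim : ∀ j ≤ d + 1, Tendsto
      (fun k => (((X - C (R k)) * g k).coeff j) / (N : ℂ) ^ k) atTop (nhds (a j)))
    (ha : a (d + 1) ≠ 0) {c : ℝ} (hc : 0 < c) (hR : ∀ᶠ k in atTop, c * N ^ k ≤ ‖R k‖) :
    Tendsto (fun k => R k / (N : ℂ) ^ k) atTop (nhds (-a (d + 1))) ∧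
      ∀ j ≤ d + 1, Tendsto (fun k => (g k).coeff j) atTop (nhds (a j / a (d + 1))) := by
  have hN0 : (0 : ℝ) < N := by linarith
  have hNC : (N : ℂ) ≠ 0 := Complex.ofReal_ne_zero.2 hN0.ne'
  have hNinv : Tendsto (fun k => (1 : ℂ) / (N : ℂ) ^ k) atTop (nhds 0) := by
    have : ‖(N : ℂ)⁻¹‖ < 1 := by
      rw [norm_inv, Complex.norm_real, Real.norm_of_nonneg hN0.le]
      exact inv_lt_one_of_one_lt₀ hN
    simpa [inv_pow] using tendsto_pow_atTop_nhds_zero_of_norm_lt_one this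
  have hR0 : ∀ᶠ k in atTop, R k ≠ 0 := by
    filter_upwards [hR] with k hk
    rw [← norm_pos_iff]
    exact lt_of_lt_of_le (by positivity) hk
  have hr : (fun k => (N : ℂ) ^ k / R k) =O[atTop] fun _ => (1 : ℂ) := by
    refine IsBigO.of_bound (1 / c) ?_
    filter_upwards [hR, hR0] with k hk hk0
    rw [norm_div, norm_pow, Complex.norm_real, Real.norm_of_nonneg hN0.le, norm_one, mul_one,
      div_le_div_iff₀ (norm_pos_iff.2 hk0) hc]
    linarith
  have hzero : ∀ᶠ k in atTop, (g k).coeff 0 =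
      (0 * (1 / (N : ℂ) ^ k) - ((X - C (R k)) * g k).coeff 0 / (N : ℂ) ^ k) *
        ((N : ℂ) ^ k / R k) := by
    filter_upwards [hR0] with k hk
    rw [mul_coeff_zero]
    simp only [coeff_sub, coeff_X_zero, coeff_C_zero]
    field_simp
    ring
  -- The relation `p_{j+1} = g_j - R g_{j+1}`, for `p = (X - R) g`, is solved for `g_{j+1}`. It
  -- first yields boundedness of all coefficients of `g`, then their convergence.
  have hsucc : ∀ j, ∀ᶠ k in atTop, (g k).coeff (j + 1) =
      ((g k).coeff j * (1 / (N : ℂ) ^ k) - ((X - C (R k)) * g k).coeff (j + 1) / (N : ℂ) ^ k) *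
        ((N : ℂ) ^ k / R k) := by
    intro j
    filter_upwards [hR0] with k hk
    rw [coeff_X_sub_C_mul]
    field_simp
    ring
  have hNO := hNinv.isBigO_one ℂ
  have hbdd : ∀ j ≤ d + 1, (fun k => (g k).coeff j) =O[atTop] fun _ => (1 : ℂ) := by
    intro j hj
    induction j with
    | zero =>
      refine IsBigO.congr' ?_ (hzero.mono fun k hk => hk.symm) EventuallyEq.rfl
      simpa using ((hNO.const_mul_left 0).sub ((hlim 0 (by omega)).isBigO_one ℂ)).mul hr
    | succ j ih =>
      refine IsBigO.congr' ?_ ((hsucc j).mono fun k hk => hk.symm) EventuallyEq.rfl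
      simpa using (((ih (by omega)).mul hNO).sub
        (((hlim (j + 1) hj).isBigO_one ℂ).congr_right fun _ => by simp)).mul hr
  have hsmall : ∀ j ≤ d + 1, Tendsto (fun k => (g k).coeff j * (1 / (N : ℂ) ^ k)) atTop
      (nhds 0) := by
    intro j hj
    have := (hbdd j hj).mul_isLittleO ((isLittleO_one_iff ℂ).2 hNinv)
    simpa using this
  -- As `g` has top coefficient 1, `R = g_d - p_{d+1}`, and the bounded `g_d` is negligible.
  have hRlim : Tendsto (fun k => R k / (N : ℂ) ^ k) atTop (nhds (-a (d + 1))) := by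
    have := (hsmall d (by omega)).sub (hlim (d + 1) le_rfl)
    rw [zero_sub] at this
    refine this.congr fun k => ?_
    rw [coeff_X_sub_C_mul, hg]
    ring
  have hrlim : Tendsto (fun k => (N : ℂ) ^ k / R k) atTop (nhds (-a (d + 1))⁻¹) :=
    (hRlim.inv₀ (neg_ne_zero.2 ha)).congr fun k => by rw [inv_div]
  refine ⟨hRlim, fun j hj => ?_⟩
  cases j with
  | zero =>
    have := ((hNinv.const_mul 0).sub (hlim 0 (by omega))).mul hrlim
    rw [show a 0 / a (d + 1) = (0 * 0 - a 0) * (-a (d + 1))⁻¹ by field_simp; ring]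
    exact this.congr' (hzero.mono fun k hk => hk.symm)
  | succ j =>
    have := ((hsmall j (by omega)).sub (hlim (j + 1) hj)).mul hrlim
    rw [show a (j + 1) / a (d + 1) = (0 - a (j + 1)) * (-a (d + 1))⁻¹ by field_simp; ring]
    exact this.congr' ((hsucc j).mono fun k hk => hk.symm)

/-- Asymptotics of the extreme roots of monic polynomials of degree `e + 2` whose lower coefficients
grow geometrically. -/
theorem extreme_roots_asymptotics {e : ℕ} {N : ℝ} (hN : 1 < N) {R : ℕ → ℂ} {ρ : ℕ → ℕ → ℂ}
    {P : ℕ → ℂ[X]} {a : ℕ → ℂ}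
    (hP : ∀ k, P k = (X - C (R k)) * ∏ i ∈ Finset.range (e + 1), (X - C (ρ k i)))
    (hlim : ∀ j ≤ e + 1, Tendsto (fun k => (P k).coeff j / (N : ℂ) ^ k) atTop (nhds (a j)))
    (ha : a (e + 1) ≠ 0) (ha0 : a 0 = 0) (ha1 : a 1 = a (e + 1))
    (hmax : ∀ k, ∀ i < e + 1, ‖ρ k i‖ ≤ ‖R k‖) (hmin : ∀ k, ∀ i < e + 1, ‖ρ k 0‖ ≤ ‖ρ k i‖) :
    Tendsto (fun k => R k / (N : ℂ) ^ k) atTop (nhds (-a (e + 1))) ∧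
      ∃ w : ℕ → ℝ, (∀ k, ‖(P k).coeff 0‖ = w k * ‖ρ k 0‖) ∧
        Tendsto (fun k => w k / N ^ k) atTop (nhds ‖a (e + 1)‖) := by
  have hN0 : (0 : ℝ) < N := by linarith
  set g : ℕ → ℂ[X] := fun k => ∏ i ∈ Finset.range (e + 1), (X - C (ρ k i)) with hgdef
  set q : ℕ → ℂ[X] := fun k => ∏ i ∈ Finset.range e, (X - C (ρ k (i + 1))) with hqdef
  have hgq : ∀ k, g k = (X - C (ρ k 0)) * q k := fun k => by
    simp only [hgdef, hqdef]
    rw [Finset.prod_range_succ', mul_comm]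
  have hgtop : ∀ k, (g k).coeff (e + 1) = 1 := fun k => by
    have h1 : (g k).Monic := monic_prod_of_monic _ _ fun i _ => monic_X_sub_C _
    have h2 : (g k).natDegree = e + 1 := by simp [hgdef]
    rw [← h2]
    exact h1
  have hqtop : ∀ k, (q k).coeff e = 1 := fun k => by
    have h1 : (q k).Monic := monic_prod_of_monic _ _ fun i _ => monic_X_sub_C _
    have h2 : (q k).natDegree = e := by simp [hqdef]
    rw [← h2]
    exact h1
  -- By Vieta this coefficient is minus the sum of `e + 2` roots, each of modulus at most `‖R k‖`;
  -- its growth thus bounds `R` from below.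
  have hsum : ∀ k, ‖(P k).coeff (e + 1)‖ ≤ (e + 2) * ‖R k‖ := fun k => by
    have h1 := prod_X_sub_C_coeff_card_pred (Finset.range (e + 1)) (fun i => ρ k i) (by simp)
    rw [Finset.card_range, Nat.add_sub_cancel] at h1
    rw [hP, coeff_X_sub_C_mul, h1, hgtop, mul_one]
    calc ‖-(∑ i ∈ Finset.range (e + 1), ρ k i) - R k‖
        ≤ ‖∑ i ∈ Finset.range (e + 1), ρ k i‖ + ‖R k‖ := by
          simpa using norm_sub_le (-(∑ i ∈ Finset.range (e + 1), ρ k i)) (R k)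
      _ ≤ ∑ i ∈ Finset.range (e + 1), ‖R k‖ + ‖R k‖ := by
          gcongr
          exact (norm_sum_le _ _).trans
            (Finset.sum_le_sum fun i hi => hmax k i (Finset.mem_range.1 hi))
      _ = _ := by
          rw [Finset.sum_const, Finset.card_range, nsmul_eq_mul]
          push_cast
          ring
  have hapos : 0 < ‖a (e + 1)‖ := norm_pos_iff.2 ha
  have hR : ∀ᶠ k in atTop, ‖a (e + 1)‖ / 2 / (e + 2) * N ^ k ≤ ‖R k‖ := by
    filter_upwards [(hlim (e + 1) le_rfl).norm.eventually (lt_mem_nhds (half_lt_self hapos))]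
      with k hk
    rw [norm_div, norm_pow, Complex.norm_real, Real.norm_of_nonneg hN0.le,
      lt_div_iff₀ (by positivity)] at hk
    rw [div_mul_eq_mul_div, div_le_iff₀ (by positivity)]
    linarith [hsum k]
  obtain ⟨hRlim, hglim⟩ := tendsto_quotient_coeff hN hgtop
    (fun j hj => (hlim j hj).congr fun k => by rw [hP]) ha (by positivity) hR
  -- Taking the product of the other moduli as `w` avoids dividing by `ρ k 0`, which may vanish.
  refine ⟨hRlim, fun k => ‖R k‖ * ‖(q k).coeff 0‖, fun k => ?_, ?_⟩
  · rw [hP]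
    change ‖((X - C (R k)) * g k).coeff 0‖ = _
    rw [hgq, mul_coeff_zero, mul_coeff_zero]
    simp
    ring
  -- By minimality `‖ρ k 0‖ ^ (e + 1)` is at most the product of the moduli of the roots of `g k`,
  -- which tends to 0 since `a 0 = 0`.
  have hρ : Tendsto (fun k => ρ k 0) atTop (nhds 0) := by
    refine tendsto_zero_of_pow_norm_le (n := e + 1) (v := fun k => (g k).coeff 0) (fun k => ?_) ?_
    · have h1 : ‖(g k).coeff 0‖ = ∏ i ∈ Finset.range (e + 1), ‖ρ k i‖ := by
        rw [coeff_zero_eq_eval_zero, eval_prod, norm_prod]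
        simp
      rw [h1]
      calc ‖ρ k 0‖ ^ (e + 1) = ∏ i ∈ Finset.range (e + 1), ‖ρ k 0‖ := by simp
        _ ≤ _ := Finset.prod_le_prod (fun _ _ => norm_nonneg _)
          fun i hi => hmin k i (Finset.mem_range.1 hi)
    · simpa [ha0] using hglim 0 (by omega)
  have hqlim : ∀ j ≤ e, Tendsto (fun k => (q k).coeff j) atTop
      (nhds (a (j + 1) / a (e + 1))) := by
    intro j hj
    refine downward_induction (P := fun j => Tendsto (fun k => (q k).coeff j) atTop
      (nhds (a (j + 1) / a (e + 1)))) (fun j hj ih => ?_) hj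
    rcases hj.eq_or_lt with rfl | hlt
    · simp only [hqtop, div_self ha]
      exact tendsto_const_nhds
    -- Here `q_j = g_{j+1} + ρ₀ q_{j+1}`, where `ρ₀ → 0` and `q_{j+1}` already converges.
    · have := (hglim (j + 1) (by omega)).add ((ih (j + 1) (by omega) hlt).mul hρ)
      rw [mul_zero, add_zero] at this
      refine this.congr fun k => ?_
      rw [hgq, coeff_X_sub_C_mul]
      ring
  have h1 := hRlim.norm.mul (hqlim 0 (by omega)).norm
  rw [zero_add, ha1, div_self ha, norm_one, mul_one, norm_neg] at h1
  refine h1.congr fun k => ?_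
  rw [norm_div, norm_pow, Complex.norm_real, Real.norm_of_nonneg hN0.le]
  ring

/-! ### Asymptotic equivalences and the main theorem -/

theorem isEquivalent_of_tendsto_div_pow {𝕜 : Type*} [NormedField 𝕜] {u : ℕ → 𝕜} {A N : 𝕜}
    (hA : A ≠ 0) (h : Tendsto (fun k => u k / N ^ k) atTop (nhds A)) :
    u ~[atTop] fun k => A * N ^ k := by
  refine isEquivalent_of_tendsto_one ?_
  have := h.div_const A
  rw [div_self hA] at this
  refine this.congr fun k => ?_
  rw [Pi.div_apply, div_div, mul_comm A]

theorem theorem2 {α : Type*} (Δ : FinSimplicialComplex α) (d : ℕ) (hd : 1 ≤ d)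
    (hdim : Δ.dim = (d : ℤ))
    (ρInf : ℕ → ℂ) (ρ : ℕ → ℕ → ℂ)
    (hroots : ∀ k, (Δ.iterSubdivision k).hPoly.aroots ℂ =
      ρInf k ::ₘ (Multiset.range d).map (ρ k))
    (hmax : ∀ k, ∀ i < d, ‖ρ k i‖ ≤ ‖ρInf k‖)
    (hmin : ∀ k, ∀ i < d, ‖ρ k 0‖ ≤ ‖ρ k i‖) :
    (ρInf ~[atTop] fun k : ℕ =>
      -((HNum 1 d : ℂ) * (Δ.numSimplices d : ℂ) * ((d + 1)! : ℂ) ^ k)) ∧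
    ((fun _ : ℕ => |(Δ.eulerChar : ℝ)|) ~[atTop] fun k : ℕ =>
      (HNum 1 d : ℝ) * (Δ.numSimplices d : ℝ) * ‖ρ k 0‖ * ((d + 1)! : ℝ) ^ k) := by
  have hdS : Δ.dimSucc = d + 1 := by
    have := hdim
    rw [FinSimplicialComplex.dim] at this
    omega
  have hne : Δ.faces.Nonempty := by
    rw [Finset.nonempty_iff_ne_empty]
    intro h
    simp [FinSimplicialComplex.dimSucc, h] at hdS
  have h0 : ∅ ∈ Δ.faces := by
    obtain ⟨σ, hσ⟩ := hne
    exact Δ.down_closed σ hσ ∅ (Finset.empty_subset _)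
  have hfd : 0 < Δ.numSimplices d := by
    rw [FinSimplicialComplex.numSimplices, ← hdS]
    exact FinSimplicialComplex.faceCount_dimSucc_pos hne
  have hH : 0 < HNum 1 d := by
    rw [HNum_one]
    exact FNum_zero_pos d
  have hN : (1 : ℝ) < ((d + 1)! : ℝ) := by
    have := Nat.self_le_factorial (d + 1)
    exact_mod_cast (show 1 < (d + 1)! by omega)
  have hP : ∀ k, (Δ.iterSubdivision k).hPoly.map (algebraMap ℤ ℂ) =
      (X - C (ρInf k)) * ∏ i ∈ Finset.range d, (X - C (ρ k i)) := by
    intro k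
    have h1 := (IsAlgClosed.splits
      ((Δ.iterSubdivision k).hPoly.map (algebraMap ℤ ℂ))).eq_prod_roots_of_monic
      ((FinSimplicialComplex.hPoly_monic
        (FinSimplicialComplex.empty_mem_iterSubdivision h0 k)).map _)
    rw [h1]
    change (Multiset.map _ ((Δ.iterSubdivision k).hPoly.aroots ℂ)).prod = _
    rw [hroots, Multiset.map_cons, Multiset.prod_cons, Multiset.map_map]
    rfl
  have hlim : ∀ j, Tendsto (fun k => ((Δ.iterSubdivision k).hPoly.map (algebraMap ℤ ℂ)).coeff j /
      (((d + 1)! : ℝ) : ℂ) ^ k) atTop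
      (nhds ((Δ.numSimplices d * limitHCoeff d j : ℝ) : ℂ)) := by
    intro j
    refine ((Complex.continuous_ofReal.tendsto _).comp
      (FinSimplicialComplex.tendsto_hPoly_coeff h0 hd hdS j)).congr fun k => ?_
    simp [coeff_map]
  obtain ⟨e, rfl⟩ : ∃ e, d = e + 1 := ⟨d - 1, by omega⟩
  have htop : ((Δ.numSimplices (e + 1) * limitHCoeff (e + 1) (e + 1) : ℝ) : ℂ) =
      ((HNum 1 (e + 1) * Δ.numSimplices (e + 1) : ℝ) : ℂ) := by
    rw [limitHCoeff_top, mul_comm]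
  have hApos : (0 : ℝ) < HNum 1 (e + 1) * Δ.numSimplices (e + 1) := by
    have : (0 : ℝ) < (HNum 1 (e + 1) : ℝ) := Rat.cast_pos.2 hH
    have : (0 : ℝ) < (Δ.numSimplices (e + 1) : ℝ) := Nat.cast_pos.2 hfd
    positivity
  have hA0 : ((HNum 1 (e + 1) * Δ.numSimplices (e + 1) : ℝ) : ℂ) ≠ 0 :=
    Complex.ofReal_ne_zero.2 hApos.ne'
  obtain ⟨hR, w, hw, hwlim⟩ := extreme_roots_asymptotics hN
    (a := fun j => ((Δ.numSimplices (e + 1) * limitHCoeff (e + 1) j : ℝ) : ℂ)) hP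
    (fun j _ => hlim j) (by simpa only [htop] using hA0) (by simp [limitHCoeff_zero hd])
    (by simp only [limitHCoeff_one hd, limitHCoeff_top]) hmax hmin
  simp only [htop] at hR hwlim
  constructor
  · have := isEquivalent_of_tendsto_div_pow (neg_ne_zero.2 hA0) hR
    refine this.congr_right (Eventually.of_forall fun k => ?_)
    simp
  · rw [Complex.norm_real, Real.norm_of_nonneg hApos.le] at hwlim
    -- Multiplying the equivalence for `w` by `‖ρ k 0‖` needs no nonvanishing, so `χ̃ = 0` is
    -- covered.
    have h1 := (isEquivalent_of_tendsto_div_pow hApos.ne' hwlim).mul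
      (IsEquivalent.refl (u := fun k => ‖ρ k 0‖) (l := atTop))
    refine (h1.congr_right (Eventually.of_forall fun k => ?_)).congr_left
      (Eventually.of_forall fun k => ?_)
    · simp only [Pi.mul_apply]
      ring
    · simp only [Pi.mul_apply]
      rw [← hw, coeff_map, ← FinSimplicialComplex.eulerChar_iterSubdivision h0 k]
      have := FinSimplicialComplex.hPoly_coeff_zero (Δ.iterSubdivision k)
      simp only [algebraMap_int_eq, eq_intCast, Complex.norm_intCast]
      exact_mod_cast this
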